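/- Let $\mu$ be a Radon measure on $\mathbb{R}^n$ and let $\Lambda:\mathbb{R}^n\to GL(n,\mathbb{R})$ be an arbitrary map. For $a\in\mathbb{R}^n$ and $r>0$ put $T_{a,r}(y)=\frac{y-a}{r}$ and $T^{\Lambda}_{a,r}(y)=\Lambda(a)^{-1}\left(\frac{y-a}{r}\right)$, and write $T[\mu]$ for the image measure $T[\mu](E)=\mu(T^{-1}(E))$. For a Radon measure $\sigma$ on $\mathbb{R}^n$ let $\mathrm{Tan}(\sigma,a)$ be the set of all nonzero Radon measures $\nu$ on $\mathbb{R}^n$ for which there are $c_i>0$ and $r_i\downarrow 0$ such that $c_i\,T_{a,r_i}[\sigma]\to\nu$ in the weak-$*$ sense (that is, $\int f\,d(c_i T_{a,r_i}[\sigma])\to\int f\,d\nu$ for every $f\in C_c(\mathbb{R}^n)$), and let $\mathrm{Tan}_\Lambda(\mu,a)$ (the $\Lambda$-tangents of $\mu$ at $a$) be defined in the same way with $c_i\,T^{\Lambda}_{a,r_i}[\mu]$ in place of $c_i\,T_{a,r_i}[\sigma]$. Then for $\mu$-almost every $a\in\mathbb{R}^n$, every $\nu\in\mathrm{Tan}_\Lambda(\mu,a)$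 has the following two properties: 1. $T_{x,r}[\nu]\in\mathrm{Tan}_\Lambda(\mu,a)$ for all $x\in\operatorname{spt}\nu$ and all $r>0$; 2. $\mathrm{Tan}(\nu,x)\subset\mathrm{Tan}_\Lambda(\mu,a)$ for all $x\in\operatorname{spt}\nu$. -/

import Mathlib

open MeasureTheory Filter Topology
open scoped NNReal ENNReal CompactlySupported

noncomputable section

/-- Weak-* convergence of a sequence of measures: convergence of the integrals of every
continuous compactly supported real function. It is only used for Radon measures, for which
all these integrals are finite. -/
def WeakStarTendsto {X : Type*} [TopologicalSpace X] [MeasurableSpace X]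
    (μs : ℕ → Measure X) (ν : Measure X) : Prop :=
  ∀ f : C_c(X, ℝ), Tendsto (fun i => ∫ x, f x ∂(μs i)) atTop (𝓝 (∫ x, f x ∂ν))

/-- The translation and scaling map `T_{a,r}(y) = (y - a) / r` of `ℝⁿ`. -/
def transScale {n : ℕ} (a : EuclideanSpace ℝ (Fin n)) (r : ℝ) (y : EuclideanSpace ℝ (Fin n)) :
    EuclideanSpace ℝ (Fin n) :=
  r⁻¹ • (y - a)

/-- The rescaling `T^Λ_{a,r}(y) = Λ(a)⁻¹ ((y - a) / r)` of `ℝⁿ`. -/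
def transScaleLambda {n : ℕ} (Λ : EuclideanSpace ℝ (Fin n) → GL (Fin n) ℝ)
    (a : EuclideanSpace ℝ (Fin n)) (r : ℝ) (y : EuclideanSpace ℝ (Fin n)) :
    EuclideanSpace ℝ (Fin n) :=
  Matrix.toEuclideanCLM (𝕜 := ℝ) (((Λ a)⁻¹ : GL (Fin n) ℝ) : Matrix (Fin n) (Fin n) ℝ)
    (transScale a r y)

/-- `Tan(μ, a)`: the nonzero Radon measures `ν` that are weak-* limits of `c_i T_{a,r_i}[μ]`
with `c_i > 0`, `r_i > 0` and `r_i → 0`. (`Measure.Regular` is Mathlib's notion of a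
Radon measure.) -/
def Tan {n : ℕ} (μ : Measure (EuclideanSpace ℝ (Fin n))) (a : EuclideanSpace ℝ (Fin n)) :
    Set (Measure (EuclideanSpace ℝ (Fin n))) :=
  {ν | ν.Regular ∧ ν ≠ 0 ∧ ∃ (c : ℕ → ℝ≥0) (r : ℕ → ℝ),
    (∀ i, 0 < c i) ∧ (∀ i, 0 < r i) ∧ Tendsto r atTop (𝓝 0) ∧
    WeakStarTendsto (fun i => c i • μ.map (transScale a (r i))) ν}

/-- `Tan_Λ(μ, a)`, the `Λ`-tangents of `μ` at `a`: the nonzero Radon measures `ν` that are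
weak-* limits of `c_i T^Λ_{a,r_i}[μ]` with `c_i > 0`, `r_i > 0` and `r_i → 0`. -/
def LambdaTan {n : ℕ} (Λ : EuclideanSpace ℝ (Fin n) → GL (Fin n) ℝ)
    (μ : Measure (EuclideanSpace ℝ (Fin n))) (a : EuclideanSpace ℝ (Fin n)) :
    Set (Measure (EuclideanSpace ℝ (Fin n))) :=
  {ν | ν.Regular ∧ ν ≠ 0 ∧ ∃ (c : ℕ → ℝ≥0) (r : ℕ → ℝ),
    (∀ i, 0 < c i) ∧ (∀ i, 0 < r i) ∧ Tendsto r atTop (𝓝 0) ∧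
    WeakStarTendsto (fun i => c i • μ.map (transScaleLambda Λ a (r i))) ν}

end

/-! A countable family `D` of test functions encodes Radon measures as vectors in `ℝ^D`, a second
countable space, in which convergence of vectors gives weak-* convergence. Being a `Λ`-tangent at
`a` then means lying in the closure of the rescalings at `a` of scale below `1/(m+1)`, for every `m`
(`mem_lambdaTan_iff`).

If `T_{x,r}[ν]` is not a tangent at `a`, some basic open `V` around its vector misses all small
rescalings at `a`. Let `B` be the set of points that share this failure and whose `Λ⁻¹` lies in a
small basic open set around `Λ(a)⁻¹`. There are only countably many such sets `B`, so almost every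
`a` is a density point of each `B` containing it. Since `x` is in the support of `ν`, the points
that the blow-ups at `a` send near `x` fill a definite proportion of small balls, so one of them,
`b`, lies in `B`. A rescaling at `b` is a small affine perturbation of `T_{x,r}` applied to a
rescaling at `a`, so its vector lies in `V`, a contradiction.

The second property follows because `Λ`-tangents are stable under positive multiples and nonzero
Radon weak-* limits. -/

/-! ### Countable families of test functions. -/

theorem exists_compactlySupported_bump {X : Type*} [TopologicalSpace X] [T2Space X]
    [LocallyCompactSpace X] {K U : Set X} (hK : IsCompact K) (hU : IsOpen U) (hKU : K ⊆ U) :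
    ∃ ψ : C_c(X, ℝ), (∀ x ∈ K, ψ x = 1) ∧ (∀ x ∉ U, ψ x = 0) ∧ ∀ x, 0 ≤ ψ x ∧ ψ x ≤ 1 := by
  obtain ⟨f, h1, h0, hc, hf⟩ := exists_continuous_one_zero_of_isCompact hK hU.isClosed_compl
    (Set.disjoint_compl_right_iff_subset.2 hKU)
  exact ⟨⟨f, hc⟩, h1, h0, hf⟩

/-- A set `D` of test functions such that every compactly supported continuous function is a limit
of elements of `D`, uniformly with respect to a fixed weight in `D`. -/
def IsWeightedDense {X : Type*} [TopologicalSpace X] (D : Set C_c(X, ℝ)) : Prop :=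
  ∀ f : C_c(X, ℝ), ∃ ψ ∈ D, ∀ ε : ℝ, 0 < ε → ∃ g ∈ D, ∀ x, |f x - g x| ≤ ε * ψ x

/-- Functions vanishing off a fixed ball form a subspace of the second countable space `C(X, ℝ)`,
hence a separable one. Bumps equal to 1 on the balls serve as weights. -/
theorem exists_countable_isWeightedDense (X : Type*) [MetricSpace X]
    [ProperSpace X] :
    ∃ D : Set C_c(X, ℝ), D.Countable ∧ IsWeightedDense D := by
  rcases isEmpty_or_nonempty X with hX | ⟨⟨o⟩⟩
  · exact ⟨{0}, Set.countable_singleton _,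
      fun f => ⟨0, rfl, fun ε _ => ⟨0, rfl, fun x => (hX.false x).elim⟩⟩⟩
  choose ψ hψ1 _ hψ using fun R : ℕ => exists_compactlySupported_bump
    (isCompact_closedBall o (R : ℝ)) isOpen_univ (Set.subset_univ _)
  let S (R : ℕ) : Set C(X, ℝ) := {h | ∀ x ∉ Metric.closedBall o (R : ℝ), h x = 0}
  let T (R : ℕ) (h : S R) : C_c(X, ℝ) :=
    ⟨h.1, HasCompactSupport.intro (isCompact_closedBall o (R : ℝ)) fun x hx => h.2 x hx⟩
  choose E hEc hEd using fun R => TopologicalSpace.exists_countable_dense (S R)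
  refine ⟨Set.range ψ ∪ ⋃ R, T R '' E R, (Set.countable_range ψ).union
    (Set.countable_iUnion fun R => (hEc R).image _), fun f => ?_⟩
  obtain ⟨r, hr⟩ := f.hasCompactSupport.isCompact.isBounded.subset_closedBall o
  obtain ⟨R, hR⟩ := exists_nat_ge r
  have hf : ∀ x ∉ Metric.closedBall o (R : ℝ), f x = 0 := fun x hx => by
    by_contra h
    exact hx (Metric.closedBall_subset_closedBall hR (hr (subset_tsupport _ h)))
  refine ⟨ψ R, Or.inl ⟨R, rfl⟩, fun ε hε => ?_⟩
  let f' : S R := ⟨f.toContinuousMap, hf⟩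
  have hnear : ∀ᶠ h : S R in 𝓝 f', ∀ x ∈ Metric.closedBall o (R : ℝ), dist (f x) (h.1 x) < ε :=
    Metric.tendstoUniformlyOn_iff.1
      (ContinuousMap.tendsto_iff_forall_isCompact_tendstoUniformlyOn.1
        (continuous_subtype_val.tendsto f') _ (isCompact_closedBall o (R : ℝ))) ε hε
  obtain ⟨h, hhE, hh⟩ := (hEd R).inter_nhds_nonempty hnear
  refine ⟨T R h, Or.inr (Set.mem_iUnion.2 ⟨R, h, hhE, rfl⟩), fun x => ?_⟩
  change |f x - h.1 x| ≤ _
  by_cases hx : x ∈ Metric.closedBall o (R : ℝ)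
  · rw [hψ1 R x hx, mul_one]
    exact (hh x hx).le
  · rw [hf x hx, h.2 x hx, sub_zero, abs_zero]
    exact mul_nonneg hε.le (hψ R x).1

/-- The integrals of a measure against the elements of a set of test functions. -/
noncomputable def testVector {X : Type*} [TopologicalSpace X] [MeasurableSpace X]
    (D : Set C_c(X, ℝ)) (σ : Measure X) : D → ℝ :=
  fun g => ∫ x, g.1 x ∂σ

/-! ### Weak-* convergence tested through weights. -/

section Convergence

variable {X : Type*} [TopologicalSpace X] [MeasurableSpace X] [BorelSpace X]

theorem abs_integral_sub_le_of_weight {σ : Measure X} [IsFiniteMeasureOnCompacts σ]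
    {h : X → ℝ} (hh : AEStronglyMeasurable h σ) (g ψ : C_c(X, ℝ)) {ε : ℝ}
    (hε : ∀ x, |h x - g x| ≤ ε * ψ x) :
    |∫ x, h x ∂σ - ∫ x, g x ∂σ| ≤ ε * ∫ x, ψ x ∂σ := by
  have hg := g.integrable (μ := σ)
  have hψ := (ψ.integrable (μ := σ)).const_mul ε
  have hd : Integrable (fun x => h x - g x) σ :=
    hψ.mono' (hh.sub hg.1) (Eventually.of_forall hε)
  have hi : Integrable h σ := (hd.add hg).congr (.of_forall fun x => by simp)
  rw [← integral_sub hi hg, ← integral_const_mul]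
  exact abs_integral_le_integral_abs.trans
    (integral_mono hd.abs hψ hε)

/-- The total masses of the `σ i` may be infinite, so uniform closeness alone gives nothing. The
integrals of the weight `ψ` converge, hence are eventually bounded, and they control the error. -/
theorem tendsto_integral_of_weight {ι : Type*} {l : Filter ι} {σ : ι → Measure X}
    [∀ i, IsFiniteMeasureOnCompacts (σ i)] {h : ι → X → ℝ}
    (hh : ∀ i, AEStronglyMeasurable (h i) (σ i)) (g ψ : C_c(X, ℝ)) {p : ℝ}
    {q : ℝ} (hg : Tendsto (fun i => ∫ x, g x ∂σ i) l (𝓝 q))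
    (hψ : Tendsto (fun i => ∫ x, ψ x ∂σ i) l (𝓝 p))
    (hε : ∀ ε : ℝ, 0 < ε → ∀ᶠ i in l, ∀ x, |h i x - g x| ≤ ε * ψ x) :
    Tendsto (fun i => ∫ x, h i x ∂σ i) l (𝓝 q) := by
  rw [Metric.tendsto_nhds] at hg ⊢
  intro ε hε0
  have hp : 0 < |p| + 1 := by positivity
  filter_upwards [hg (ε / 2) (half_pos hε0), hε (ε / 2 / (|p| + 1)) (by positivity),
    hψ.eventually_lt_const (lt_of_le_of_lt (le_abs_self p) (lt_add_one _))] with i h1 h2 h3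
  have h4 := abs_integral_sub_le_of_weight (hh i) g ψ h2
  have h5 : ε / 2 / (|p| + 1) * ∫ x, ψ x ∂σ i ≤ ε / 2 := by
    refine (mul_le_mul_of_nonneg_left h3.le (by positivity)).trans ?_
    rw [div_mul_cancel₀ _ hp.ne']
  rw [Real.dist_eq] at h1 ⊢
  have := abs_sub_le (∫ x, h i x ∂σ i) (∫ x, g x ∂σ i) q
  linarith

theorem weakStarTendsto_of_testVector {D : Set C_c(X, ℝ)} (hD : IsWeightedDense D)
    {σ : ℕ → Measure X} {ν : Measure X} [∀ i, IsFiniteMeasureOnCompacts (σ i)]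
    [IsFiniteMeasureOnCompacts ν]
    (h : Tendsto (fun i => testVector D (σ i)) atTop (𝓝 (testVector D ν))) :
    WeakStarTendsto σ ν := by
  intro f
  have h' (g) (hg : g ∈ D) := (tendsto_pi_nhds.1 h) ⟨g, hg⟩
  simp only [testVector] at h'
  obtain ⟨ψ, hψD, hψ⟩ := hD f
  rw [Metric.tendsto_nhds]
  intro ε hε
  set p := ∫ x, ψ x ∂ν
  have hp : 0 < |p| + 1 := by positivity
  obtain ⟨g, hgD, hg⟩ := hψ (ε / 3 / (|p| + 1)) (by positivity)
  have hw : ∀ q : ℝ, q < |p| + 1 → ε / 3 / (|p| + 1) * q ≤ ε / 3 := fun q hq => by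
    refine (mul_le_mul_of_nonneg_left hq.le (by positivity)).trans ?_
    rw [div_mul_cancel₀ _ hp.ne']
  have hpl : p < |p| + 1 := lt_of_le_of_lt (le_abs_self p) (lt_add_one _)
  filter_upwards [Metric.tendsto_nhds.1 (h' g hgD) (ε / 3) (by positivity),
    (h' ψ hψD).eventually_lt_const hpl] with i h1 h2
  have h3 := (abs_integral_sub_le_of_weight (f.integrable (μ := σ i)).1 g ψ hg).trans (hw _ h2)
  have h4 := (abs_integral_sub_le_of_weight (f.integrable (μ := ν)).1 g ψ hg).trans (hw _ hpl)
  rw [Real.dist_eq] at h1 ⊢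
  rw [abs_le] at h3 h4
  rw [abs_lt] at h1 ⊢
  constructor <;> linarith [h1.1, h1.2, h3.1, h3.2, h4.1, h4.2]

end Convergence

/-- Integrals against converging affine perturbations of a test function. -/
theorem tendsto_integral_comp_affine {E : Type*} [NormedAddCommGroup E] [NormedSpace ℝ E]
    [FiniteDimensional ℝ E] [MeasurableSpace E] [BorelSpace E] {σ : ℕ → Measure E}
    {ν : Measure E} [∀ i, IsFiniteMeasureOnCompacts (σ i)] (h : WeakStarTendsto σ ν)
    (A₀ : E ≃L[ℝ] E) (x : E) (f : C_c(E, ℝ)) :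
    Tendsto (fun p : ℕ × (E →L[ℝ] E) × E => ∫ z, f (p.2.1 (z - p.2.2)) ∂σ p.1)
      (atTop ×ˢ 𝓝 ((A₀ : E →L[ℝ] E), x)) (𝓝 (∫ z, f (A₀ (z - x)) ∂ν)) := by
  have : ProperSpace E := FiniteDimensional.proper ℝ E
  obtain ⟨R₀, hR₀⟩ := f.hasCompactSupport.isCompact.isBounded.subset_closedBall 0
  have hf : ∀ y, R₀ < ‖y‖ → f y = 0 := fun y hy => by
    by_contra hne
    have := hR₀ (subset_tsupport _ hne)
    rw [mem_closedBall_zero_iff] at this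
    exact absurd hy this.not_gt
  obtain ⟨K, hK, hAK⟩ : ∃ K : ℝ, 0 < K ∧ ∀ v, K * ‖v‖ ≤ ‖A₀ v‖ := by
    refine ⟨(‖(A₀.symm : E →L[ℝ] E)‖ + 1)⁻¹, by positivity, fun v => ?_⟩
    rw [inv_mul_le_iff₀ (by positivity)]
    have := (A₀.symm : E →L[ℝ] E).le_opNorm (A₀ v)
    simp only [ContinuousLinearEquiv.coe_coe, ContinuousLinearEquiv.symm_apply_apply] at this
    nlinarith [norm_nonneg (A₀ v)]
  -- For maps within `K / 2` of `A₀` and centres within 1 of `x`, `‖z‖ > R` forces the image of `z`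
  -- outside the ball of radius `R₀`: all perturbed functions vanish off one common ball.
  set R := |R₀| * (2 / K) + ‖x‖ + 1
  have hsupp : ∀ᶠ q : (E →L[ℝ] E) × E in 𝓝 ((A₀ : E →L[ℝ] E), x),
      ∀ z ∉ Metric.closedBall (0 : E) R, f (q.1 (z - q.2)) = 0 := by
    have h1 : ∀ᶠ q : (E →L[ℝ] E) × E in 𝓝 ((A₀ : E →L[ℝ] E), x),
        q ∈ Metric.ball (A₀ : E →L[ℝ] E) (K / 2) ×ˢ Metric.ball x 1 :=
      prod_mem_nhds (Metric.ball_mem_nhds _ (by positivity)) (Metric.ball_mem_nhds _ one_pos)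
    filter_upwards [h1] with q hq z hz
    obtain ⟨hq1, hq2⟩ := hq
    rw [mem_ball_iff_norm] at hq1 hq2
    rw [mem_closedBall_zero_iff, not_le] at hz
    apply hf
    have h2 : K / 2 * ‖z - q.2‖ ≤ ‖q.1 (z - q.2)‖ := by
      have h3 := (q.1 - (A₀ : E →L[ℝ] E)).le_of_opNorm_le hq1.le (z - q.2)
      have h4 := hAK (z - q.2)
      have h5 : ‖A₀ (z - q.2)‖ ≤ ‖q.1 (z - q.2)‖ + ‖(q.1 - (A₀ : E →L[ℝ] E)) (z - q.2)‖ := by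
        refine le_trans (le_of_eq ?_) (norm_sub_le _ _)
        simp
      linarith
    have h6 : |R₀| * (2 / K) < ‖z - q.2‖ := by
      have h7 : ‖z‖ ≤ ‖z - q.2‖ + ‖q.2 - x‖ + ‖x‖ := by
        have := norm_add₃_le (a := z - q.2) (b := q.2 - x) (c := x)
        simpa using this
      linarith
    calc R₀ ≤ |R₀| := le_abs_self _
      _ = K / 2 * (|R₀| * (2 / K)) := by field_simp
      _ < K / 2 * ‖z - q.2‖ := by gcongr
      _ ≤ _ := h2
  have hz₀ := hsupp.self_of_nhds
  let g : C_c(E, ℝ) := ⟨⟨fun z => f (A₀ (z - x)), by fun_prop⟩,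
    HasCompactSupport.intro (isCompact_closedBall 0 R) hz₀⟩
  obtain ⟨ψ, hψ1, -, hψ⟩ := exists_compactlySupported_bump
    (isCompact_closedBall (0 : E) R) isOpen_univ (Set.subset_univ _)
  refine tendsto_integral_of_weight (σ := fun p : ℕ × (E →L[ℝ] E) × E => σ p.1)
    (h := fun p z => f (p.2.1 (z - p.2.2)))
    (fun p => (by fun_prop : Continuous fun z => f (p.2.1 (z - p.2.2))).aestronglyMeasurable)
    g ψ ((h g).comp tendsto_fst) ((h ψ).comp tendsto_fst) fun ε hε => ?_
  -- Currying turns joint continuity into uniform convergence on compact sets as the affine map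
  -- varies.
  let F : C(((E →L[ℝ] E) × E) × E, ℝ) := ⟨fun q => f (q.1.1 (q.2 - q.1.2)), by fun_prop⟩
  have hunif : ∀ᶠ q : (E →L[ℝ] E) × E in 𝓝 ((A₀ : E →L[ℝ] E), x),
      ∀ z ∈ Metric.closedBall (0 : E) R, dist (f (A₀ (z - x))) (f (q.1 (z - q.2))) < ε :=
    Metric.tendstoUniformlyOn_iff.1
      (ContinuousMap.tendsto_iff_forall_isCompact_tendstoUniformlyOn.1
        (F.curry.continuous.tendsto ((A₀ : E →L[ℝ] E), x)) _ (isCompact_closedBall 0 R)) ε hε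
  filter_upwards [tendsto_snd.eventually (hsupp.and hunif)] with p hp z
  change |f (p.2.1 (z - p.2.2)) - f (A₀ (z - x))| ≤ _
  by_cases hz : z ∈ Metric.closedBall (0 : E) R
  · rw [hψ1 z hz, mul_one, abs_sub_comm]
    exact (hp.2 z hz).le
  · have : f (A₀ (z - x)) = 0 := hz₀ z hz
    rw [hp.1 z hz, this, sub_zero, abs_zero]
    exact mul_nonneg hε.le (hψ z).1

/-! ### Density points and points of the support. -/

/-- At a density point `a` of a set `B`, the set `B` meets every sequence of subsets of balls
shrinking to `a` that carry a definite proportion of the measure of these balls. -/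
theorem eventually_nonempty_inter_of_density {X : Type*} [PseudoMetricSpace X] [ProperSpace X]
    [MeasurableSpace X] {μ : Measure X} [IsFiniteMeasureOnCompacts μ] {B : Set X} {a : X}
    (hB : Tendsto (fun r => μ (B ∩ Metric.closedBall a r) / μ (Metric.closedBall a r)) (𝓝[>] 0)
      (𝓝 1))
    {s : ℕ → ℝ} (hs : ∀ i, 0 < s i) (hs0 : Tendsto s atTop (𝓝 0)) {G : ℕ → Set X}
    (hG : ∀ i, MeasurableSet (G i)) (hGs : ∀ i, G i ⊆ Metric.closedBall a (s i)) {η : ℝ}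
    (hη : 0 < η)
    (hμ : ∀ᶠ i in atTop, 0 < μ.real (G i) ∧
      η * μ.real (Metric.closedBall a (s i)) ≤ μ.real (G i)) :
    ∀ᶠ i in atTop, (B ∩ G i).Nonempty := by
  have hs' : Tendsto s atTop (𝓝[>] 0) :=
    tendsto_nhdsWithin_iff.2 ⟨hs0, Eventually.of_forall hs⟩
  have h1 := (ENNReal.tendsto_toReal ENNReal.one_ne_top).comp (hB.comp hs')
  have h2 := h1.eventually_const_lt (show 1 - η < ENNReal.toReal 1 by simpa using hη)
  filter_upwards [h2, hμ] with i hi ⟨hpos, hle⟩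
  by_contra hne
  rw [Set.not_nonempty_iff_eq_empty] at hne
  have hfin : μ (Metric.closedBall a (s i)) ≠ ∞ := (isCompact_closedBall a (s i)).measure_ne_top
  -- If `B` misses `G i`, its share of the ball is at most `1 - η`. Only `G i` has to be measurable
  -- here.
  have h3 : μ.real (B ∩ Metric.closedBall a (s i)) ≤
      μ.real (Metric.closedBall a (s i)) - μ.real (G i) := by
    rw [← measureReal_sdiff (hGs i) (hG i) hfin]
    refine measureReal_mono (fun y hy => ⟨hy.2, fun hyG => ?_⟩)
      (measure_ne_top_of_subset Set.sdiff_subset hfin)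
    exact (hne ▸ (⟨hy.1, hyG⟩ : y ∈ B ∩ G i) : y ∈ (∅ : Set X))
  have h4 : 0 < μ.real (Metric.closedBall a (s i)) :=
    hpos.trans_le (measureReal_mono (hGs i) hfin)
  simp only [Function.comp_apply, ENNReal.toReal_div] at hi
  change 1 - η < μ.real _ / μ.real _ at hi
  rw [lt_div_iff₀ h4] at hi
  linarith

section TestFunctionBounds

variable {X : Type*} [TopologicalSpace X] [MeasurableSpace X] [BorelSpace X] {σ : Measure X}
  [IsFiniteMeasureOnCompacts σ]

theorem integral_le_measureReal {U : Set X} (hU : MeasurableSet U) (hUσ : σ U ≠ ∞) (φ : C_c(X, ℝ))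
    (h0 : ∀ x ∉ U, φ x = 0) (h1 : ∀ x, φ x ≤ 1) : ∫ x, φ x ∂σ ≤ σ.real U := by
  rw [← integral_indicator_one hU]
  refine integral_mono φ.integrable ((integrable_indicator_iff hU).2 (integrableOn_const hUσ))
    fun x => ?_
  by_cases hx : x ∈ U
  · simpa [hx] using h1 x
  · simp [hx, h0 x hx]

theorem measureReal_le_integral {C : Set X} (hC : MeasurableSet C) (hCσ : σ C ≠ ∞) (ψ : C_c(X, ℝ))
    (h1 : ∀ x ∈ C, ψ x = 1) (h0 : ∀ x, 0 ≤ ψ x) : σ.real C ≤ ∫ x, ψ x ∂σ := by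
  rw [← integral_indicator_one hC]
  refine integral_mono ((integrable_indicator_iff hC).2 (integrableOn_const hCσ)) ψ.integrable
    fun x => ?_
  by_cases hx : x ∈ C
  · simp [hx, h1 x hx]
  · simpa [hx] using h0 x

end TestFunctionBounds

/-- The weight of a neighbourhood of a point of the support of a weak-* limit is eventually
comparable to the weight of a compact set. -/
theorem WeakStarTendsto.eventually_measureReal_comparable {X : Type*} [TopologicalSpace X]
    [T2Space X] [LocallyCompactSpace X] [MeasurableSpace X] [BorelSpace X] {σ : ℕ → Measure X}
    {ν : Measure X} [∀ i, IsFiniteMeasureOnCompacts (σ i)] [IsFiniteMeasureOnCompacts ν]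
    (h : WeakStarTendsto σ ν) {x : X} (hx : x ∈ ν.support) {U C : Set X} (hU : IsOpen U)
    (hxU : x ∈ U) (hC : IsCompact C) (hUC : U ⊆ C) :
    ∃ η : ℝ, 0 < η ∧ ∀ᶠ i in atTop,
      0 < (σ i).real U ∧ η * (σ i).real C ≤ (σ i).real U := by
  obtain ⟨φ, hφ1, hφ0, hφ⟩ := exists_compactlySupported_bump (isCompact_singleton (x := x)) hU
    (Set.singleton_subset_iff.2 hxU)
  obtain ⟨ψ, hψ1, -, hψ⟩ := exists_compactlySupported_bump hC isOpen_univ (Set.subset_univ C)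
  have hα : 0 < ∫ y, φ y ∂ν := by
    rw [integral_pos_iff_support_of_nonneg (fun y => (hφ y).1) φ.integrable]
    refine (Measure.mem_support_iff_forall x).1 hx _ ?_
    refine φ.continuous.isOpen_support.mem_nhds ?_
    exact (hφ1 x rfl).trans_ne one_ne_zero
  have hβ : 0 ≤ ∫ y, ψ y ∂ν := integral_nonneg fun y => (hψ y).1
  set α := ∫ y, φ y ∂ν
  set β := ∫ y, ψ y ∂ν
  refine ⟨α / 2 / (β + 1), by positivity, ?_⟩
  filter_upwards [(h φ).eventually_const_lt (half_lt_self hα),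
    (h ψ).eventually_lt_const (lt_add_one β)] with i h1 h2
  have hCσ : σ i C ≠ ∞ := hC.measure_ne_top
  have h3 := integral_le_measureReal hU.measurableSet (measure_ne_top_of_subset hUC hCσ) φ hφ0
    fun y => (hφ y).2
  have h4 := measureReal_le_integral hC.measurableSet hCσ ψ hψ1 fun y => (hψ y).1
  refine ⟨(half_pos hα).trans (h1.trans_le h3), ?_⟩
  calc α / 2 / (β + 1) * (σ i).real C ≤ α / 2 / (β + 1) * (β + 1) := by
        gcongr
        exact h4.trans h2.le
    _ = α / 2 := div_mul_cancel₀ _ (by positivity)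
    _ ≤ _ := (h1.trans_le h3).le

/-! ### Rescalings and the closure description of `Λ`-tangents. -/

section Rescaling

variable {n : ℕ}

/-- `Λ(a)⁻¹` as a continuous linear automorphism. -/
noncomputable def lambdaInv (Λ : EuclideanSpace ℝ (Fin n) → GL (Fin n) ℝ)
    (a : EuclideanSpace ℝ (Fin n)) : EuclideanSpace ℝ (Fin n) ≃L[ℝ] EuclideanSpace ℝ (Fin n) :=
  ContinuousLinearEquiv.equivOfInverse
    (Matrix.toEuclideanCLM (𝕜 := ℝ) (((Λ a)⁻¹ : GL (Fin n) ℝ) : Matrix (Fin n) (Fin n) ℝ))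
    (Matrix.toEuclideanCLM (𝕜 := ℝ) ((Λ a : GL (Fin n) ℝ) : Matrix (Fin n) (Fin n) ℝ))
    (fun x => by
      rw [← mul_apply_eq_comp, ← map_mul, Units.mul_inv, map_one,
        one_apply_eq_self])
    (fun x => by
      rw [← mul_apply_eq_comp, ← map_mul, Units.inv_mul, map_one,
        one_apply_eq_self])

/-- `transScale` as a homeomorphism. -/
noncomputable def transScaleHomeomorph (a : EuclideanSpace ℝ (Fin n)) {r : ℝ} (hr : 0 < r) :
    EuclideanSpace ℝ (Fin n) ≃ₜ EuclideanSpace ℝ (Fin n) :=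
  (Homeomorph.subRight a).trans (Homeomorph.smulOfNeZero r⁻¹ (inv_pos.2 hr).ne')

theorem transScaleLambda_eq (Λ : EuclideanSpace ℝ (Fin n) → GL (Fin n) ℝ)
    (a : EuclideanSpace ℝ (Fin n)) (r : ℝ) (y : EuclideanSpace ℝ (Fin n)) :
    transScaleLambda Λ a r y = lambdaInv Λ a (r⁻¹ • (y - a)) := rfl

theorem continuous_transScaleLambda (Λ : EuclideanSpace ℝ (Fin n) → GL (Fin n) ℝ)
    (a : EuclideanSpace ℝ (Fin n)) (r : ℝ) : Continuous (transScaleLambda Λ a r) := by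
  simp only [funext (transScaleLambda_eq Λ a r)]
  fun_prop

/-- `transScaleLambda` as a homeomorphism. -/
noncomputable def transScaleLambdaHomeomorph (Λ : EuclideanSpace ℝ (Fin n) → GL (Fin n) ℝ)
    (a : EuclideanSpace ℝ (Fin n)) {r : ℝ} (hr : 0 < r) :
    EuclideanSpace ℝ (Fin n) ≃ₜ EuclideanSpace ℝ (Fin n) :=
  (transScaleHomeomorph a hr).trans (lambdaInv Λ a).toHomeomorph

theorem regular_map_transScale (ν : Measure (EuclideanSpace ℝ (Fin n))) [ν.Regular]
    (a : EuclideanSpace ℝ (Fin n)) {r : ℝ} (hr : 0 < r) : (ν.map (transScale a r)).Regular :=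
  Measure.Regular.map (transScaleHomeomorph a hr)

theorem regular_map_transScaleLambda (μ : Measure (EuclideanSpace ℝ (Fin n))) [μ.Regular]
    (Λ : EuclideanSpace ℝ (Fin n) → GL (Fin n) ℝ)
    (a : EuclideanSpace ℝ (Fin n)) {r : ℝ} (hr : 0 < r) :
    (μ.map (transScaleLambda Λ a r)).Regular :=
  Measure.Regular.map (transScaleLambdaHomeomorph Λ a hr)

/-- Change of base point and scale in a rescaling. -/
theorem transScaleLambda_mul (Λ : EuclideanSpace ℝ (Fin n) → GL (Fin n) ℝ)
    (a b : EuclideanSpace ℝ (Fin n)) (s r : ℝ)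
    (w : EuclideanSpace ℝ (Fin n)) :
    transScaleLambda Λ b (s * r) w =
      (r⁻¹ • ((lambdaInv Λ b : EuclideanSpace ℝ (Fin n) →L[ℝ] EuclideanSpace ℝ (Fin n)).comp
        ((lambdaInv Λ a).symm : EuclideanSpace ℝ (Fin n) →L[ℝ] EuclideanSpace ℝ (Fin n))))
        (transScaleLambda Λ a s w - transScaleLambda Λ a s b) := by
  have h : transScaleLambda Λ a s w - transScaleLambda Λ a s b =
      lambdaInv Λ a (s⁻¹ • (w - b)) := by
    rw [transScaleLambda_eq, transScaleLambda_eq, ← map_sub, ← smul_sub, sub_sub_sub_cancel_right]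
  rw [h, transScaleLambda_eq, mul_inv, mul_smul]
  simp only [map_smul, FunLike.coe_smul, Pi.smul_apply, ContinuousLinearMap.comp_apply,
    ContinuousLinearEquiv.coe_coe, ContinuousLinearEquiv.symm_apply_apply]

theorem integral_smul_map {E : Type*} [TopologicalSpace E] [MeasurableSpace E] [BorelSpace E]
    (μ : Measure E) {T : E → E} (hT : Continuous T) (c : ℝ≥0) {f : E → ℝ} (hf : Continuous f) :
    ∫ y, f y ∂(c • μ.map T) = c • ∫ y, f (T y) ∂μ := by
  rw [integral_smul_nnreal_measure,
    integral_map_of_stronglyMeasurable hT.measurable hf.stronglyMeasurable]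

/-- The test vectors of the positive multiples of the rescalings of `μ` at `a` with scale less
than `1 / (m + 1)`. -/
def rescalingVectors (D : Set C_c(EuclideanSpace ℝ (Fin n), ℝ))
    (Λ : EuclideanSpace ℝ (Fin n) → GL (Fin n) ℝ) (μ : Measure (EuclideanSpace ℝ (Fin n)))
    (m : ℕ) (a : EuclideanSpace ℝ (Fin n)) : Set (D → ℝ) :=
  {v | ∃ c : ℝ≥0, 0 < c ∧ ∃ r : ℝ, 0 < r ∧ r < 1 / ((m : ℝ) + 1) ∧
    v = testVector D (c • μ.map (transScaleLambda Λ a r))}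

theorem mem_lambdaTan_iff {D : Set C_c(EuclideanSpace ℝ (Fin n), ℝ)} (hDc : D.Countable)
    (hD : IsWeightedDense D) (Λ : EuclideanSpace ℝ (Fin n) → GL (Fin n) ℝ)
    (μ : Measure (EuclideanSpace ℝ (Fin n))) [μ.Regular] (a : EuclideanSpace ℝ (Fin n))
    (ν : Measure (EuclideanSpace ℝ (Fin n))) :
    ν ∈ LambdaTan Λ μ a ↔ ν.Regular ∧ ν ≠ 0 ∧
      ∀ m, testVector D ν ∈ closure (rescalingVectors D Λ μ m a) := by
  have := hDc.to_subtype
  constructor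
  · rintro ⟨hν, h0, c, r, hc, hr, hr0, h⟩
    refine ⟨hν, h0, fun m => mem_closure_of_tendsto
      (f := fun i => testVector D (c i • μ.map (transScaleLambda Λ a (r i))))
      (tendsto_pi_nhds.2 fun g => h g.1) ?_⟩
    filter_upwards [hr0.eventually_lt_const (show (0 : ℝ) < 1 / ((m : ℝ) + 1) by positivity)]
      with i hi
    exact ⟨c i, hc i, r i, hr i, hi, rfl⟩
  · rintro ⟨hν, h0, h⟩
    -- A diagonal choice: the `m`-th rescaling has scale below `1/(m+1)` and its vector lies in the
    -- `m`-th neighbourhood.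
    obtain ⟨u, hu⟩ := (𝓝 (testVector D ν)).exists_antitone_basis
    have h' : ∀ m : ℕ, ∃ (c : ℝ≥0) (r : ℝ), 0 < c ∧ 0 < r ∧ r < 1 / ((m : ℝ) + 1) ∧
        testVector D (c • μ.map (transScaleLambda Λ a r)) ∈ u m := fun m => by
      obtain ⟨-, ⟨hv, c, hc, r, hr, hrm, rfl⟩⟩ :=
        mem_closure_iff_nhds.1 (h m) (u m) (hu.toHasBasis.mem_of_mem trivial)
      exact ⟨c, r, hc, hr, hrm, hv⟩
    choose c r hc hr hrm hv using h'
    have (i : ℕ) : (μ.map (transScaleLambda Λ a (r i))).Regular :=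
      regular_map_transScaleLambda μ Λ a (hr i)
    exact ⟨hν, h0, c, r, hc, hr, squeeze_zero (fun i => (hr i).le) (fun i => (hrm i).le)
      tendsto_one_div_add_atTop_nhds_zero_nat, weakStarTendsto_of_testVector hD (hu.tendsto hv)⟩

theorem smul_mem_lambdaTan {Λ : EuclideanSpace ℝ (Fin n) → GL (Fin n) ℝ}
    {μ ν : Measure (EuclideanSpace ℝ (Fin n))} {a : EuclideanSpace ℝ (Fin n)}
    (hν : ν ∈ LambdaTan Λ μ a) {t : ℝ≥0} (ht : 0 < t) : t • ν ∈ LambdaTan Λ μ a := by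
  obtain ⟨hreg, h0, c, r, hc, hr, hr0, h⟩ := hν
  refine ⟨inferInstance, smul_ne_zero ht.ne' h0, fun i => t * c i, r, fun i => mul_pos ht (hc i),
    hr, hr0, fun f => ?_⟩
  simp only [mul_smul, integral_smul_nnreal_measure _ t]
  exact (h f).const_smul t

/-- Nonzero Radon measures that are weak-* limits of `Λ`-tangents are `Λ`-tangents. -/
theorem mem_lambdaTan_of_weakStarTendsto {Λ : EuclideanSpace ℝ (Fin n) → GL (Fin n) ℝ}
    {μ : Measure (EuclideanSpace ℝ (Fin n))} [μ.Regular] {a : EuclideanSpace ℝ (Fin n)}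
    {σ : ℕ → Measure (EuclideanSpace ℝ (Fin n))} (hσ : ∀ i, σ i ∈ LambdaTan Λ μ a)
    {τ : Measure (EuclideanSpace ℝ (Fin n))} (hτ : τ.Regular) (h0 : τ ≠ 0)
    (h : WeakStarTendsto σ τ) : τ ∈ LambdaTan Λ μ a := by
  obtain ⟨D, hDc, hD⟩ := exists_countable_isWeightedDense (EuclideanSpace ℝ (Fin n))
  rw [mem_lambdaTan_iff hDc hD]
  refine ⟨hτ, h0, fun m => isClosed_closure.mem_of_tendsto (f := fun i => testVector D (σ i))
    (tendsto_pi_nhds.2 fun g => h g.1) (Eventually.of_forall fun i => ?_)⟩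
  exact ((mem_lambdaTan_iff hDc hD Λ μ a _).1 (hσ i)).2.2 m

end Rescaling

/-! ### The density argument and the theorem. -/

/-- At almost every point `a`, the rescalings of a `Λ`-tangent at points of its support are again
`Λ`-tangents at `a`. The map `Λ` need not be measurable: almost every point of an arbitrary set is a
density point of it for the outer measure. -/
theorem ae_map_transScale_mem_lambdaTan {n : ℕ} (μ : Measure (EuclideanSpace ℝ (Fin n)))
    [μ.Regular] (Λ : EuclideanSpace ℝ (Fin n) → GL (Fin n) ℝ) :
    ∀ᵐ a ∂μ, ∀ ν ∈ LambdaTan Λ μ a, ∀ x ∈ ν.support, ∀ r : ℝ, 0 < r →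
      ν.map (transScale x r) ∈ LambdaTan Λ μ a := by
  obtain ⟨D, hDc, hD⟩ := exists_countable_isWeightedDense (EuclideanSpace ℝ (Fin n))
  have := hDc.to_subtype
  let E := EuclideanSpace ℝ (Fin n)
  let 𝒱 := TopologicalSpace.countableBasis (D → ℝ)
  let 𝒲 := TopologicalSpace.countableBasis (E →L[ℝ] E)
  let B (V : Set (D → ℝ)) (W : Set (E →L[ℝ] E)) (m : ℕ) : Set E :=
    {b | (lambdaInv Λ b : E →L[ℝ] E) ∈ W ∧ Disjoint (rescalingVectors D Λ μ m b) V}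
  have hdens : ∀ᵐ a ∂μ, ∀ V ∈ 𝒱, ∀ W ∈ 𝒲, ∀ m : ℕ, a ∈ B V W m →
      Tendsto (fun r => μ (B V W m ∩ Metric.closedBall a r) / μ (Metric.closedBall a r)) (𝓝[>] 0)
        (𝓝 1) := by
    refine (ae_ball_iff (TopologicalSpace.countable_countableBasis _)).2 fun V _ =>
      (ae_ball_iff (TopologicalSpace.countable_countableBasis _)).2 fun W _ =>
      ae_all_iff.2 fun m => ae_imp_of_ae_restrict ?_
    exact Besicovitch.ae_tendsto_measure_inter_div μ (B V W m)
  filter_upwards [hdens] with a ha ν hν x hx r hr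
  have hνreg : ν.Regular := hν.1
  rw [mem_lambdaTan_iff hDc hD]
  refine ⟨regular_map_transScale ν x hr, (Measure.map_ne_zero_iff
    (transScaleHomeomorph x hr).continuous.aemeasurable).2 hν.2.1, fun m => ?_⟩
  by_contra hm
  obtain ⟨V, hV𝒱, hV, hVsub⟩ := (TopologicalSpace.isBasis_countableBasis _).mem_nhds_iff.1
    (isClosed_closure.isOpen_compl.mem_nhds hm)
  obtain ⟨-, -, c, s, hc, hs, hs0, hlim⟩ := hν
  have (i : ℕ) : (μ.map (transScaleLambda Λ a (s i))).Regular :=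
    regular_map_transScaleLambda μ Λ a (hs i)
  let A₀ : E ≃L[ℝ] E := ContinuousLinearEquiv.equivOfInverse
    (r⁻¹ • ContinuousLinearMap.id ℝ E) (r • ContinuousLinearMap.id ℝ E)
    (fun y => by simp [smul_smul, hr.ne']) (fun y => by simp [smul_smul, hr.ne'])
  have hA₀ : (A₀ : E →L[ℝ] E) = r⁻¹ • ContinuousLinearMap.id ℝ E := rfl
  have hvec : Tendsto (fun p : ℕ × (E →L[ℝ] E) × E => fun g : D =>
      ∫ z, g.1 (p.2.1 (z - p.2.2)) ∂(c p.1 • μ.map (transScaleLambda Λ a (s p.1))))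
      (atTop ×ˢ 𝓝 ((A₀ : E →L[ℝ] E), x)) (𝓝 (testVector D (ν.map (transScale x r)))) := by
    refine tendsto_pi_nhds.2 fun g => ?_
    have h1 := tendsto_integral_comp_affine hlim A₀ x g.1
    have h2 : testVector D (ν.map (transScale x r)) g = ∫ z, g.1 (A₀ (z - x)) ∂ν :=
      integral_map_of_stronglyMeasurable (transScaleHomeomorph x hr).continuous.measurable
        g.1.continuous.stronglyMeasurable
    rwa [h2]
  -- `V` is reached once three conditions hold: `pa` (large index), `qa` (linear part near `A₀`),
  -- `qb` (centre within `ε` of `x`).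
  obtain ⟨pa, hpa, pb, hpb, hp⟩ := eventually_prod_iff.1 (hvec.eventually
    ((TopologicalSpace.isOpen_of_mem_countableBasis hV𝒱).mem_nhds hV))
  rw [nhds_prod_eq] at hpb
  obtain ⟨qa, hqa, qb, hqb, hq⟩ := eventually_prod_iff.1 hpb
  obtain ⟨ε, hε, hball⟩ := Metric.eventually_nhds_iff_ball.1 hqb
  have hcomp : Continuous fun N : E →L[ℝ] E =>
      r⁻¹ • N.comp ((lambdaInv Λ a).symm : E →L[ℝ] E) := by fun_prop
  have hcomp0 : r⁻¹ • (lambdaInv Λ a : E →L[ℝ] E).comp ((lambdaInv Λ a).symm : E →L[ℝ] E) =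
      (A₀ : E →L[ℝ] E) := by
    rw [hA₀, ContinuousLinearEquiv.coe_comp_coe_symm]
  obtain ⟨W, hW𝒲, hW, hWsub⟩ := (TopologicalSpace.isBasis_countableBasis _).mem_nhds_iff.1
    ((hcomp.tendsto' _ _ hcomp0).eventually hqa)
  have haB : a ∈ B V W m := ⟨hW, Set.disjoint_left.2 fun v hv hvV =>
    hVsub hvV (subset_closure hv)⟩
  obtain ⟨ρ₀, hρ₀⟩ := ((isCompact_closedBall x ε).image
    (lambdaInv Λ a).symm.continuous).isBounded.subset_closedBall 0
  set ρ := |ρ₀| + 1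
  have hρpos : 0 < ρ := add_pos_of_nonneg_of_pos (abs_nonneg _) one_pos
  -- This ellipsoid is used because its preimages under the rescalings at `a` are round balls, as
  -- the density statement requires.
  let C : Set E := lambdaInv Λ a '' Metric.closedBall 0 ρ
  have hC : IsCompact C := (isCompact_closedBall 0 ρ).image (lambdaInv Λ a).continuous
  have hUC : Metric.ball x ε ⊆ C := fun z hz => by
    refine ⟨(lambdaInv Λ a).symm z, ?_, (lambdaInv Λ a).apply_symm_apply z⟩
    have h1 := hρ₀ (Set.mem_image_of_mem _ (Metric.ball_subset_closedBall hz))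
    rw [mem_closedBall_zero_iff] at h1 ⊢
    linarith [le_abs_self ρ₀]
  have hpre (i : ℕ) : transScaleLambda Λ a (s i) ⁻¹' C = Metric.closedBall a (s i * ρ) := by
    ext y
    rw [Set.mem_preimage, transScaleLambda_eq, (lambdaInv Λ a).injective.mem_set_image,
      mem_closedBall_zero_iff, mem_closedBall_iff_norm, norm_smul, norm_inv, Real.norm_eq_abs,
      abs_of_pos (hs i), inv_mul_le_iff₀ (hs i)]
  obtain ⟨η, hη, hηi⟩ := hlim.eventually_measureReal_comparable hx Metric.isOpen_ball
    (Metric.mem_ball_self hε) hC hUC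
  have hcont (i : ℕ) := continuous_transScaleLambda Λ a (s i)
  have hmeet := eventually_nonempty_inter_of_density (ha V hV𝒱 W hW𝒲 m haB)
    (fun i => mul_pos (hs i) hρpos) (by simpa using hs0.mul_const ρ)
    (G := fun i => transScaleLambda Λ a (s i) ⁻¹' Metric.ball x ε)
    (fun i => (hcont i).measurable Metric.isOpen_ball.measurableSet)
    (fun i => hpre i ▸ Set.preimage_mono hUC) hη (by
      filter_upwards [hηi] with i hi
      have hci : (0 : ℝ) < c i := hc i
      rw [measureReal_nnreal_smul_apply, measureReal_nnreal_smul_apply,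
        map_measureReal_apply (hcont i).measurable hC.measurableSet,
        map_measureReal_apply (hcont i).measurable Metric.isOpen_ball.measurableSet, hpre,
        mul_left_comm] at hi
      exact ⟨pos_of_mul_pos_right hi.1 hci.le, le_of_mul_le_mul_left hi.2 hci⟩)
  have hsmall := (hs0.mul_const r).eventually_lt_const
    (show 0 * r < 1 / ((m : ℝ) + 1) by rw [zero_mul]; positivity)
  -- The rescaling at `b` of scale `s i * r` has its vector in `V`, which membership of `b` in `B V
  -- W m` forbids.
  obtain ⟨i, ⟨b, hbB, hbG⟩, hi, hpi⟩ := (hmeet.and (hsmall.and hpa)).exists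
  refine Set.disjoint_left.1 hbB.2 ⟨c i, hc i, s i * r, mul_pos (hs i) hr, hi, rfl⟩ ?_
  refine Set.mem_of_eq_of_mem (funext fun g => ?_) (hp hpi (hq (hWsub hbB.1) (hball _ hbG)))
  simp only [testVector]
  rw [integral_smul_map μ (continuous_transScaleLambda Λ b _) _ (map_continuous g.1),
    integral_smul_map μ (hcont i) _ (by fun_prop)]
  simp only [transScaleLambda_mul Λ a b (s i) r]

theorem theoremt {n : ℕ} (μ : Measure (EuclideanSpace ℝ (Fin n))) [μ.Regular]
    (Λ : EuclideanSpace ℝ (Fin n) → GL (Fin n) ℝ) :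
    ∀ᵐ a ∂μ, ∀ ν ∈ LambdaTan Λ μ a,
      (∀ x ∈ ν.support, ∀ r : ℝ, 0 < r → ν.map (transScale x r) ∈ LambdaTan Λ μ a) ∧
      (∀ x ∈ ν.support, Tan ν x ⊆ LambdaTan Λ μ a) := by
  filter_upwards [ae_map_transScale_mem_lambdaTan μ Λ] with a ha ν hν
  refine ⟨ha ν hν, fun x hx τ ⟨hτ, h0, c, r, hc, hr, _, h⟩ => ?_⟩
  exact mem_lambdaTan_of_weakStarTendsto
    (fun i => smul_mem_lambdaTan (ha ν hν x hx (r i) (hr i)) (hc i)) hτ h0 h
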